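/- **Corollary 5.2.1 (IPW under confounding).** Let $W$ be observed covariates (values in any measurable space, discrete or continuous), $T\in\{0,1\}$ a treatment, $Y\in\mathbb R$ an outcome, and $U$ an unobserved confounder. For a distribution $D$ of $(W,T,Y)$ put $h^\infty(x_D)=E_D[Y\mid T=1]-E_D[Y\mid T=0]$, and let $L(a,b)=|a-b|$. *Setting.* Let $\kappa(\cdot\mid w,t)$ be the causal mechanism, i.e. the uncontaminated law of $Y$ given $W=w,T=t$, and let $\sigma_t(w)$ be its standard deviation and $\sigma(w)=\max(\sigma_0(w),\sigma_1(w))$. - The target $P$ has $T$ independent of $W$, $P(T=t)>0$ for $t=0,1$, $P(Y\mid W,T)=\kappa$, and $Y$ is integrable under $P$. - The observed (source) distribution $Q$ follows the Huber contamination model $Q(Y\mid T,W)=(1-\eta)\,\kappa(\cdot\mid W,T)+\eta\,E_{U\mid T,W}\big[N(\cdot\mid W,T,U)\big]$, with arbitrary contaminating laws $N$ and an arbitrary conditional law of $U$ given $(T,W)$. Overlap holds: $Q(T=t\mid W)>0$ almost surely for $t=0,1$. - The fourth moments of the uncontaminated outcome are bounded: for $Q$-almost every $(w,t)$, $\int (y-\mu)^4\,\kappa(dy\mid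 w,t)\le C\,\sigma_t(w)^4<\infty$, where $\mu$ is the mean of $\kappa(\cdot\mid w,t)$ and $C\ge 0$; moreover $\int\sigma\,dQ(W)<\infty$. - $Q_B$ is the robust version of $Q$ given by the one-dimensional mean estimator of Lai, Rao and Vempala with parameters $\eta$ and $\varepsilon>0$, applied to the conditional laws: $Q_B(W,T)=Q(W,T)$, and $Q_B(Y\mid W=w,T=t)$ is $Q(Y\mid W=w,T=t)$ conditioned on a shortest interval of $Q(Y\mid W=w,T=t)$-mass at least $(1-\eta)(1-\eta-\varepsilon)$. - $R$ is the IPW representation, i.e. $Q_B$ reweighted by the density ratio $\beta(W,T=t)=Q_B(W)/Q_B(W\mid T=t)$; in particular $R(W\mid T=t)=R(W)=Q(W)$. *Claim.* For every $\delta>0$ there is a constant $K>0$, depending only on $\delta$, such that whenever $0\le\eta\le1$, $\varepsilon>0$, $(1-\eta)(1-\eta-\varepsilon)\ge\eta+\delta$ and $P(W)=Q(W)=R(W)$, the outcome $Y$ is integrable under $R$ and $$L\big(h^\infty(x_R),h^\infty(x_P)\big)=2\gamma,\qquad \gamma=\sum_W Q(W)\,O\big(C^{1/4}(\eta+\varepsilon)^{3/4}\sigma(W)\big),$$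 with implied constant $K$. That is, there is a measurable $g$ with $0\le g(w)\le K\,C^{1/4}(\eta+\varepsilon)^{3/4}\sigma(w)$ for all $w$ and $L(h^\infty(x_R),h^\infty(x_P))=2\int g\,dQ(W)$ (a sum over $w$ if $W$ is discrete). In particular the bias is at most $2K\,C^{1/4}(\eta+\varepsilon)^{3/4}\int\sigma\,dQ(W)$. -/

import Mathlib

open MeasureTheory ProbabilityTheory
open scoped ENNReal

noncomputable section

namespace CausalIPW

/-! A distribution of the observed variables `(W, T, Y)` is a measure on `(W × Fin 2) × ℝ`:
covariates `W`, binary treatment `T`, real outcome `Y`. The conditional law of `Y` given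
`(W, T)` under `D` is `D.condKernel`, the joint law of `(W, T)` is `D.fst`. -/

variable {W : Type*} [MeasurableSpace W]

/-- The marginal law `D(W)`. -/
def lawW (D : Measure ((W × Fin 2) × ℝ)) : Measure W :=
  D.fst.fst

/-- The event `T = t`. -/
def treated (W : Type*) (t : Fin 2) : Set ((W × Fin 2) × ℝ) :=
  {ω | ω.1.2 = t}

/-- The conditional law `D(W | T = t)`. -/
def lawWGiven (D : Measure ((W × Fin 2) × ℝ)) (t : Fin 2) : Measure W :=
  lawW (D[|treated W t])

/-- The conditional expectation `E_D[Y | T = t]`. -/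
def meanGiven (D : Measure ((W × Fin 2) × ℝ)) (t : Fin 2) : ℝ :=
  ∫ ω, ω.2 ∂(D[|treated W t])

/-- The infinite-sample average predictive effect
`h^∞(x_D) = E_D[Y | T = 1] - E_D[Y | T = 0]`. -/
def hInf (D : Measure ((W × Fin 2) × ℝ)) : ℝ :=
  meanGiven D 1 - meanGiven D 0

/-- The `L1` loss. -/
def lossL1 (x y : ℝ) : ℝ := |x - y|

/-- Overlap: `Q(T = t | W) > 0` almost surely, for both treatments. -/
def Overlap (Q : Measure ((W × Fin 2) × ℝ)) [IsFiniteMeasure Q] : Prop :=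
  ∀ t : Fin 2, ∀ᵐ w ∂(lawW Q), 0 < Q.fst.condKernel w {t}

/-- The IPW weight `β(w, t) = D(W) / D(W | T = t)`, as a density ratio. -/
def ipwWeight (D : Measure ((W × Fin 2) × ℝ)) (w : W) (t : Fin 2) : ℝ≥0∞ :=
  (lawW D).rnDeriv (lawWGiven D t) w

/-- The IPW representation: `D` reweighted by the IPW weight. -/
def ipwRepresentation (D : Measure ((W × Fin 2) × ℝ)) : Measure ((W × Fin 2) × ℝ) :=
  D.withDensity fun ω => ipwWeight D ω.1.1 ω.1.2

/-- `P` is a target (interventional) distribution for the causal mechanism `κ(w, t) = law of Y`: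
treatment is randomized, i.e. independent of `W`, both treatments occur, and the outcome is
generated from `(W, T)` by `κ`. -/
structure IsTarget (κ : Kernel (W × Fin 2) ℝ) (P : Measure ((W × Fin 2) × ℝ)) : Prop where
  randomized : P.fst = P.fst.fst.prod P.fst.snd
  both_arms : ∀ t : Fin 2, 0 < P.fst.snd {t}
  mechanism : P = P.fst ⊗ₘ κ

/-- Huber contamination of the outcome by the unobserved confounder `U`: given `(W, T)`, with
probability `1 - η` the outcome is drawn from the causal mechanism `κ`, and with probability `η`
from a law `N` that may depend on `W`, `T` and `U`. Here `ν` is the conditional law of `U` given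
`(W, T)`. -/
def IsHuberContaminated {U : Type*} [MeasurableSpace U] (η : ℝ) (κ : Kernel (W × Fin 2) ℝ)
    (ν : Kernel (W × Fin 2) U) (N : Kernel ((W × Fin 2) × U) ℝ)
    (Q : Measure ((W × Fin 2) × ℝ)) [IsFiniteMeasure Q] : Prop :=
  ∀ᵐ x ∂Q.fst, Q.condKernel x =
    ENNReal.ofReal (1 - η) • κ x + ENNReal.ofReal η • (ν x).bind fun u => N (x, u)

/-- `[a, b]` is a shortest interval of `μ`-mass at least `m`. -/
def IsShortestInterval (μ : Measure ℝ) (m a b : ℝ) : Prop :=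
  a ≤ b ∧ ENNReal.ofReal m ≤ μ (Set.Icc a b) ∧
    ∀ a' b' : ℝ, a' ≤ b' → ENNReal.ofReal m ≤ μ (Set.Icc a' b') → b - a ≤ b' - a'

/-- `QB` is a robust version of `Q`: it has the same law of `(W, T)`, and its outcome law given
`(W, T)` is the one of `Q` restricted to (and renormalized on) a shortest interval that contains
a fraction `(1 - η)(1 - η - ε)` of it. The conditional mean of `Y` under `QB` is thus the
one-dimensional agnostic mean of Lai, Rao and Vempala applied to the observed conditional law. -/
def IsRobustVersion (η ε : ℝ) (Q QB : Measure ((W × Fin 2) × ℝ))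
    [IsFiniteMeasure Q] [IsFiniteMeasure QB] : Prop :=
  QB.fst = Q.fst ∧
    ∀ᵐ x ∂Q.fst, ∃ a b : ℝ,
      IsShortestInterval (Q.condKernel x) ((1 - η) * (1 - η - ε)) a b ∧
        QB.condKernel x = (Q.condKernel x)[|Set.Icc a b]

/-- The standard deviation of the uncontaminated outcome given `W = w`, `T = t`. -/
def condSD (κ : Kernel (W × Fin 2) ℝ) (w : W) (t : Fin 2) : ℝ :=
  Real.sqrt (variance id (κ (w, t)))

/-- The larger of the standard deviations of the two treatment arms given `W = w`. -/
def sigma (κ : Kernel (W × Fin 2) ℝ) (w : W) : ℝ :=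
  max (condSD κ w 0) (condSD κ w 1)

/-- Bounded conditional fourth moments, `E[(Y - μ)^4 | T, W] ≤ C σ^4`, for the uncontaminated
outcome. -/
def FourthMomentBound (C : ℝ) (κ : Kernel (W × Fin 2) ℝ)
    (Q : Measure ((W × Fin 2) × ℝ)) : Prop :=
  ∀ᵐ x ∂Q.fst, MemLp (id : ℝ → ℝ) 4 (κ x) ∧
    ∫ y, (y - ∫ z, z ∂(κ x)) ^ 4 ∂(κ x) ≤ C * condSD κ x.1 x.2 ^ 4

end CausalIPW

end

namespace CausalIPW

/-! Conditioning on `T = t` turns both averages into integrals over the same covariate law `Q(W)`.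
For `P` this is randomization. For the reweighted law it holds because the weight is exactly the
density of `Q_B(W)` with respect to `Q_B(W | T = t)`, which exists by overlap. The error in each arm
is therefore the `Q(W)`-integral of a one-dimensional bias, the robust mean minus the mean of `κ`.
The factor 2 counts the two arms, and `g` is a rescaling of the pointwise bound.

The one-dimensional estimate (`abs_integral_cond_interval_sub_le`) takes `q = (1 - η) μ + n` with
`n` of mass `η`, `c` the mean of `μ`, fourth central moment at most `B ^ 4`, and `v = (η + ε) ^
(1/4)`. By Chebyshev, `c ± B / v` is a competitor for the shortest interval `I`, so `I` has length
at most `2 B / v`. It also carries `μ`-mass at least `δ`, hence meets a neighbourhood of `c` and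
lies within `O(B / v)` of it. The contamination inside `I` then shifts the integral by at most `η *
O(B / v) = O(B v ^ 3)`. Cutting `μ` down to `I` loses only a tail of mass `O(v ^ 4)`, which costs
`O(B v ^ 3)` as well. -/

/-- A fourth-moment Chebyshev inequality. -/
lemma measureReal_mul_pow_four_le {μ : Measure ℝ} [IsProbabilityMeasure μ] {c B s : ℝ}
    (hint : Integrable (fun y => (y - c) ^ 4) μ) (hB : ∫ y, (y - c) ^ 4 ∂μ ≤ B ^ 4)
    (hs : 0 ≤ s) {A : Set ℝ} (hA : ∀ y ∈ A, s ≤ |y - c|) :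
    μ.real A * s ^ 4 ≤ B ^ 4 := by
  have h := mul_meas_ge_le_integral_of_nonneg (μ := μ) (f := fun y => (y - c) ^ 4)
    (Filter.Eventually.of_forall fun y => by positivity) hint (s ^ 4)
  have hsub : A ⊆ {y | s ^ 4 ≤ (y - c) ^ 4} := fun y hy => by
    have := pow_le_pow_left₀ hs (hA y hy) 4
    simpa [Even.pow_abs (by decide : Even 4)] using this
  have h2 := measureReal_mono (μ := μ) hsub
  nlinarith [pow_nonneg hs 4]

/-- Truncated first moments are controlled by fourth moments. -/
lemma abs_le_add_pow_four_div {s : ℝ} (hs : 0 < s) (z : ℝ) : |z| ≤ s + z ^ 4 / s ^ 3 := by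
  rcases le_total |z| s with h | h
  · have : 0 ≤ z ^ 4 / s ^ 3 := by positivity
    linarith
  · have h1 : |z| ≤ z ^ 4 / s ^ 3 := by
      rw [le_div_iff₀ (by positivity), ← Even.pow_abs (by decide : Even 4)]
      have := pow_le_pow_left₀ hs.le h 3
      nlinarith [abs_nonneg z]
    linarith

lemma integrable_sub_pow_four {μ : Measure ℝ} [IsProbabilityMeasure μ]
    (h : MemLp (id : ℝ → ℝ) 4 μ) (c : ℝ) : Integrable (fun y => (y - c) ^ 4) μ := by
  have h1 : MemLp (fun y : ℝ => y - c) 4 μ := h.sub (memLp_const c)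
  have h2 := h1.integrable_norm_pow (p := 4) (by norm_num)
  refine h2.congr (Filter.Eventually.of_forall fun y => ?_)
  simp [Even.pow_abs (by decide : Even 4)]

/-- Lets the estimates below assume `B > 0`, so that the scale `B / v` is positive; the degenerate
case `B = 0` follows by letting `B'` decrease to `B`. -/
lemma le_mul_of_forall_gt {x k B : ℝ} (hk : 0 < k) (h : ∀ B', B < B' → x ≤ k * B') :
    x ≤ k * B := by
  rw [← div_le_iff₀' hk]
  exact le_of_forall_gt_imp_ge_of_dense fun B' hB' => by
    rw [div_le_iff₀' hk]; exact h B' hB'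

/-- The constant controlling the distance from the true mean to the shortest interval. -/
noncomputable def rangeConst (δ : ℝ) : ℝ := 2 + 2 / δ ^ (1 / 4 : ℝ)

/-- The constant controlling the error of the one-dimensional robust mean. -/
noncomputable def biasConst (δ : ℝ) : ℝ := (rangeConst δ + (2 / δ + 1)) / δ

lemma rangeConst_pos {δ : ℝ} (hδ : 0 < δ) : 0 < rangeConst δ := by
  unfold rangeConst; positivity

lemma biasConst_pos {δ : ℝ} (hδ : 0 < δ) : 0 < biasConst δ := by
  have := rangeConst_pos hδ
  unfold biasConst; positivity

/-! ### The shortest-interval mean under contamination -/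

section Interval

variable {δ η ε : ℝ} {μ n q : Measure ℝ} [IsProbabilityMeasure μ]

lemma contamination_lt_one (hδ : 0 < δ) (hη : 0 ≤ η) (hη1 : η ≤ 1)
    (hm : η + δ ≤ (1 - η) * (1 - η - ε)) : η + ε < 1 := by
  by_contra! h
  nlinarith [mul_nonneg (sub_nonneg.2 hη1) (sub_nonneg.2 h)]

lemma real_eq_mix [IsFiniteMeasure n] (hη1 : η ≤ 1)
    (hq : q = ENNReal.ofReal (1 - η) • μ + n) (A : Set ℝ) :
    q.real A = (1 - η) * μ.real A + n.real A := by
  have h : (ENNReal.ofReal (1 - η) • μ) A ≠ ∞ := by simp [ENNReal.mul_eq_top]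
  rw [hq, measureReal_add_apply h, measureReal_ennreal_smul_apply,
    ENNReal.toReal_ofReal (by linarith)]

variable [IsProbabilityMeasure q] {a b : ℝ}

lemma isFiniteMeasure_of_mix (hq : q = ENNReal.ofReal (1 - η) • μ + n) : IsFiniteMeasure n := by
  refine ⟨lt_of_le_of_lt ?_ (measure_lt_top q Set.univ)⟩
  rw [hq]; simp

lemma le_real_interval (hI : IsShortestInterval q ((1 - η) * (1 - η - ε)) a b) :
    (1 - η) * (1 - η - ε) ≤ q.real (Set.Icc a b) :=
  (ENNReal.ofReal_le_iff_le_toReal (measure_ne_top _ _)).1 hI.2.1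

lemma abs_sub_le_of_mem_interval_of_pos {B : ℝ} (hδ : 0 < δ) (hη : 0 ≤ η) (hη1 : η ≤ 1)
    (hε : 0 < ε) (hm : η + δ ≤ (1 - η) * (1 - η - ε))
    (hq : q = ENNReal.ofReal (1 - η) • μ + n) {c : ℝ}
    (hint : Integrable (fun y => (y - c) ^ 4) μ) (hB0 : 0 < B)
    (hB : ∫ y, (y - c) ^ 4 ∂μ ≤ B ^ 4)
    (hI : IsShortestInterval q ((1 - η) * (1 - η - ε)) a b) {y : ℝ} (hy : y ∈ Set.Icc a b) :
    |y - c| ≤ rangeConst δ / (η + ε) ^ (1 / 4 : ℝ) * B := by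
  have := isFiniteMeasure_of_mix hq
  have hθ1 := contamination_lt_one hδ hη hη1 hm
  have hθ : 0 < η + ε := by linarith
  obtain ⟨v, hv⟩ : ∃ v, v = (η + ε) ^ (1 / 4 : ℝ) := ⟨_, rfl⟩
  obtain ⟨d, hd⟩ : ∃ d, d = δ ^ (1 / 4 : ℝ) := ⟨_, rfl⟩
  have hv0 : 0 < v := hv ▸ Real.rpow_pos_of_pos hθ _
  have hd0 : 0 < d := hd ▸ Real.rpow_pos_of_pos hδ _
  have hv1 : v ≤ 1 := hv ▸ Real.rpow_le_one hθ.le hθ1.le (by norm_num)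
  have hv4 : v ^ 4 = η + ε := by
    rw [hv, ← Real.rpow_natCast, ← Real.rpow_mul hθ.le]; norm_num
  have hd4 : d ^ 4 = δ := by
    rw [hd, ← Real.rpow_natCast, ← Real.rpow_mul hδ.le]; norm_num
  -- At radius `B / v` Chebyshev leaves `μ`-mass at most `v ^ 4 = η + ε` outside, so `c ± B / v` has
  -- enough `q`-mass to compete with `[a, b]`.
  have hlen : b - a ≤ 2 * (B / v) := by
    have hs : 0 < B / v := by positivity
    have hJ : ENNReal.ofReal ((1 - η) * (1 - η - ε)) ≤
        q (Set.Icc (c - B / v) (c + B / v)) := by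
      rw [ENNReal.ofReal_le_iff_le_toReal (measure_ne_top _ _)]
      change _ ≤ q.real _
      rw [real_eq_mix hη1 hq]
      have h1 := measureReal_mul_pow_four_le hint hB hs.le
        (A := (Set.Icc (c - B / v) (c + B / v))ᶜ) (fun y hy => by
          by_contra! h
          rw [abs_lt] at h
          exact hy ⟨by linarith, by linarith⟩)
      rw [probReal_compl_eq_one_sub measurableSet_Icc, div_pow, hv4, mul_div_assoc',
        div_le_iff₀ hθ, mul_comm, mul_le_mul_iff_right₀ (by positivity)] at h1
      have h2 : 0 ≤ n.real (Set.Icc (c - B / v) (c + B / v)) := measureReal_nonneg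
      nlinarith
    have := hI.2.2 (c - B / v) (c + B / v) (by linarith) hJ
    linarith
  -- The interval has `q`-mass at least `η + δ`, of which the contamination supplies at most `η`.
  have hμI : δ ≤ μ.real (Set.Icc a b) := by
    have h1 := le_real_interval hI
    rw [real_eq_mix hη1 hq] at h1
    have h2 := real_eq_mix hη1 hq Set.univ
    simp only [probReal_univ, mul_one] at h2
    have h3 : n.real (Set.Icc a b) ≤ n.real Set.univ := measureReal_mono (Set.subset_univ _)
    have h4 : 0 ≤ μ.real (Set.Icc a b) := measureReal_nonneg
    nlinarith
  -- Otherwise Chebyshev would give the interval `μ`-mass at most `δ / 16`.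
  obtain ⟨z, hz, hzc⟩ : ∃ z ∈ Set.Icc a b, |z - c| < 2 * (B / d) := by
    by_contra! h
    have h1 := measureReal_mul_pow_four_le hint hB (s := 2 * (B / d)) (by positivity) h
    have h2 : (2 * (B / d)) ^ 4 = 16 * B ^ 4 / δ := by rw [← hd4]; ring
    rw [h2, mul_div_assoc', div_le_iff₀ hδ] at h1
    have : 0 < B ^ 4 := by positivity
    nlinarith
  have hyz : |y - z| ≤ b - a := by
    rw [abs_le]; constructor <;> linarith [hy.1, hy.2, hz.1, hz.2]
  have htri : |y - c| ≤ |y - z| + |z - c| := abs_sub_le _ _ _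
  have hdv : B / d ≤ B / d / v := by
    rw [le_div_iff₀ hv0]
    exact mul_le_of_le_one_right (by positivity) hv1
  have : rangeConst δ / (η + ε) ^ (1 / 4 : ℝ) * B = 2 * (B / v) + 2 * (B / d / v) := by
    rw [rangeConst, ← hv, ← hd]; ring
  linarith

lemma abs_sub_le_of_mem_interval {B : ℝ} (hδ : 0 < δ) (hη : 0 ≤ η) (hη1 : η ≤ 1)
    (hε : 0 < ε) (hm : η + δ ≤ (1 - η) * (1 - η - ε))
    (hq : q = ENNReal.ofReal (1 - η) • μ + n) {c : ℝ}
    (hint : Integrable (fun y => (y - c) ^ 4) μ) (hB0 : 0 ≤ B)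
    (hB : ∫ y, (y - c) ^ 4 ∂μ ≤ B ^ 4)
    (hI : IsShortestInterval q ((1 - η) * (1 - η - ε)) a b) {y : ℝ} (hy : y ∈ Set.Icc a b) :
    |y - c| ≤ rangeConst δ / (η + ε) ^ (1 / 4 : ℝ) * B := by
  have hk : 0 < rangeConst δ / (η + ε) ^ (1 / 4 : ℝ) :=
    div_pos (rangeConst_pos hδ) (Real.rpow_pos_of_pos (by linarith) _)
  refine le_mul_of_forall_gt hk fun B' hB' => ?_
  exact abs_sub_le_of_mem_interval_of_pos hδ hη hη1 hε hm hq hint (hB0.trans_lt hB')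
    (hB.trans (pow_le_pow_left₀ hB0 hB'.le 4)) hI hy

lemma abs_integral_cond_interval_sub_le_of_pos {B : ℝ} (hδ : 0 < δ) (hη : 0 ≤ η) (hη1 : η ≤ 1)
    (hε : 0 < ε) (hm : η + δ ≤ (1 - η) * (1 - η - ε))
    (hq : q = ENNReal.ofReal (1 - η) • μ + n) (hL : MemLp (id : ℝ → ℝ) 4 μ) (hB0 : 0 < B)
    (hB : ∫ y, (y - ∫ z, z ∂μ) ^ 4 ∂μ ≤ B ^ 4)
    (hI : IsShortestInterval q ((1 - η) * (1 - η - ε)) a b) :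
    |(∫ y, y ∂(q[|Set.Icc a b])) - ∫ z, z ∂μ| ≤ biasConst δ * (η + ε) ^ (3 / 4 : ℝ) * B := by
  have := isFiniteMeasure_of_mix hq
  have hid : Integrable (fun y : ℝ => y) μ := hL.integrable (by norm_num)
  set c := ∫ z, z ∂μ with hc
  have hint := integrable_sub_pow_four hL c
  have hθ1 := contamination_lt_one hδ hη hη1 hm
  have hθ : 0 < η + ε := by linarith
  have hrange : ∀ y ∈ Set.Icc a b, |y - c| ≤ rangeConst δ / (η + ε) ^ (1 / 4 : ℝ) * B :=
    fun y hy => abs_sub_le_of_mem_interval_of_pos hδ hη hη1 hε hm hq hint hB0 hB hI hy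
  obtain ⟨v, hv⟩ : ∃ v, v = (η + ε) ^ (1 / 4 : ℝ) := ⟨_, rfl⟩
  have hv0 : 0 < v := hv ▸ Real.rpow_pos_of_pos hθ _
  have hv4 : v ^ 4 = η + ε := by
    rw [hv, ← Real.rpow_natCast, ← Real.rpow_mul hθ.le]; norm_num
  have hv3 : (η + ε) ^ (3 / 4 : ℝ) = v ^ 3 := by
    rw [hv, ← Real.rpow_natCast, ← Real.rpow_mul hθ.le]; norm_num
  rw [← hv] at hrange
  set I := Set.Icc a b with hIdef
  have hImeas : MeasurableSet I := measurableSet_Icc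
  have hqI : (1 - η) * (1 - η - ε) ≤ q.real I := le_real_interval hI
  have hqI0 : 0 < q.real I := by linarith
  have hR := rangeConst_pos hδ
  have hnI : n.real I ≤ η := by
    have h2 := real_eq_mix hη1 hq Set.univ
    simp only [probReal_univ, mul_one] at h2
    have h3 : n.real I ≤ n.real Set.univ := measureReal_mono (Set.subset_univ _)
    linarith
  have hidI : ∀ ρ : Measure ℝ, [IsFiniteMeasure ρ] → IntegrableOn (fun y => y) I ρ := fun ρ _ =>
    (continuous_id.continuousOn).integrableOn_compact isCompact_Icc
  -- reduction to the integral over the interval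
  have hcond : (∫ y, y ∂(q[|I])) - c = (q.real I)⁻¹ * ∫ y in I, (y - c) ∂q := by
    have h0 : q.real I ≠ 0 := hqI0.ne'
    rw [ProbabilityTheory.cond, integral_smul_measure, integral_sub (hidI q) (integrable_const c)]
    simp only [integral_const, measureReal_restrict_apply_univ, smul_eq_mul, ENNReal.toReal_inv]
    change (q.real I)⁻¹ * _ - c = _
    field_simp
  have hsplit : ∫ y in I, (y - c) ∂q =
      (1 - η) * (∫ y in I, (y - c) ∂μ) + ∫ y in I, (y - c) ∂n := by
    have hμI : Integrable (fun y => y - c) (ENNReal.ofReal (1 - η) • μ.restrict I) :=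
      ((hidI μ).sub (integrable_const c)).smul_measure ENNReal.ofReal_ne_top
    rw [hq, Measure.restrict_add, Measure.restrict_smul,
      integral_add_measure hμI ((hidI n).sub (integrable_const c)), integral_smul_measure,
      ENNReal.toReal_ofReal (by linarith), smul_eq_mul]
  -- Range times mass: `n` has mass at most `η ≤ v ^ 4`, and one factor `v` is lost to the range.
  have hn : |∫ y in I, (y - c) ∂n| ≤ rangeConst δ * B * v ^ 3 := by
    have h1 := norm_setIntegral_le_of_norm_le_const (μ := n) (measure_lt_top n I)
      (f := fun y => y - c) hrange
    rw [Real.norm_eq_abs] at h1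
    refine h1.trans ?_
    have h2 : rangeConst δ * B * v ^ 3 = rangeConst δ / v * B * (η + ε) := by
      rw [← hv4]; field_simp
    rw [h2]
    exact mul_le_mul_of_nonneg_left (by linarith) (by positivity)
  have hμ : |(1 - η) * ∫ y in I, (y - c) ∂μ| ≤ (2 / δ + 1) * B * v ^ 3 := by
    have hsub : Integrable (fun y => y - c) μ := hid.sub (integrable_const c)
    -- Since `c` is the mean of `μ`, only the discarded tail matters.
    have h1 : ∫ y in I, (y - c) ∂μ = - ∫ y in Iᶜ, (y - c) ∂μ := by
      have := integral_add_compl hImeas hsub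
      rw [integral_sub hid (integrable_const c)] at this
      simp only [integral_const, probReal_univ, one_smul] at this
      linarith
    have hs : 0 < B / v := by positivity
    -- Truncation at `s = B / v` makes both terms of order `B v ^ 3` once `μ.real Iᶜ` is `O(v ^ 4)`.
    have h2 : |∫ y in Iᶜ, (y - c) ∂μ| ≤ B / v * μ.real Iᶜ + B * v ^ 3 := by
      calc |∫ y in Iᶜ, (y - c) ∂μ| ≤ ∫ y in Iᶜ, |y - c| ∂μ := abs_integral_le_integral_abs
        _ ≤ ∫ y in Iᶜ, (B / v + (y - c) ^ 4 / (B / v) ^ 3) ∂μ := by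
            refine integral_mono hsub.abs.integrableOn
              ((integrable_const _).add (hint.integrableOn.div_const _)) fun y => ?_
            exact abs_le_add_pow_four_div hs _
        _ = B / v * μ.real Iᶜ + (∫ y in Iᶜ, (y - c) ^ 4 ∂μ) / (B / v) ^ 3 := by
            rw [integral_add (integrable_const _) (hint.integrableOn.div_const _),
              integral_div ((B / v) ^ 3)]
            simp [mul_comm]
        _ ≤ B / v * μ.real Iᶜ + B ^ 4 / (B / v) ^ 3 := by
            gcongr
            exact (setIntegral_le_integral hint
              (Filter.Eventually.of_forall fun y => by positivity)).trans hB
        _ = B / v * μ.real Iᶜ + B * v ^ 3 := by field_simp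
    -- The mass bound on `q` gives `(1 - η) μ(Iᶜ) ≤ (1 - η)(η + ε) + η ≤ 2 (η + ε)`, and `δ ≤ 1 -
    -- η`.
    have h3 : δ * μ.real Iᶜ ≤ 2 * v ^ 4 := by
      have h4 := real_eq_mix hη1 hq I
      rw [probReal_compl_eq_one_sub hImeas, hv4]
      have h5 : μ.real I ≤ 1 := measureReal_le_one
      have h6 : δ ≤ 1 - η := by nlinarith
      have h7 : δ * (1 - μ.real I) ≤ (1 - η) * (1 - μ.real I) :=
        mul_le_mul_of_nonneg_right h6 (by linarith)
      nlinarith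
    have h4 : B / v * μ.real Iᶜ ≤ 2 / δ * B * v ^ 3 := by
      have : μ.real Iᶜ ≤ 2 * v ^ 4 / δ := by rw [le_div_iff₀ hδ]; linarith
      calc B / v * μ.real Iᶜ ≤ B / v * (2 * v ^ 4 / δ) := by gcongr
        _ = 2 / δ * B * v ^ 3 := by field_simp
    rw [abs_mul, h1, abs_neg, abs_of_nonneg (by linarith : 0 ≤ 1 - η)]
    calc (1 - η) * |∫ y in Iᶜ, (y - c) ∂μ| ≤ |∫ y in Iᶜ, (y - c) ∂μ| :=
          mul_le_of_le_one_left (abs_nonneg _) (by linarith)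
      _ ≤ _ := by linarith
  have htot : |∫ y in I, (y - c) ∂q| ≤ (rangeConst δ + (2 / δ + 1)) * B * v ^ 3 := by
    rw [hsplit]
    refine (abs_add_le _ _).trans ?_
    linarith
  rw [hcond, abs_mul, abs_inv, abs_of_pos hqI0, hv3, biasConst, inv_mul_le_iff₀ hqI0]
  have hd : δ ≤ q.real I := by linarith
  calc |∫ y in I, (y - c) ∂q| ≤ (rangeConst δ + (2 / δ + 1)) * B * v ^ 3 := htot
    _ = δ * ((rangeConst δ + (2 / δ + 1)) / δ * v ^ 3 * B) := by field_simp
    _ ≤ _ := by gcongr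

/-- The error of the one-dimensional robust mean under Huber contamination. -/
lemma abs_integral_cond_interval_sub_le {B : ℝ} (hδ : 0 < δ) (hη : 0 ≤ η) (hη1 : η ≤ 1)
    (hε : 0 < ε) (hm : η + δ ≤ (1 - η) * (1 - η - ε))
    (hq : q = ENNReal.ofReal (1 - η) • μ + n) (hL : MemLp (id : ℝ → ℝ) 4 μ) (hB0 : 0 ≤ B)
    (hB : ∫ y, (y - ∫ z, z ∂μ) ^ 4 ∂μ ≤ B ^ 4)
    (hI : IsShortestInterval q ((1 - η) * (1 - η - ε)) a b) :
    |(∫ y, y ∂(q[|Set.Icc a b])) - ∫ z, z ∂μ| ≤ biasConst δ * (η + ε) ^ (3 / 4 : ℝ) * B := by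
  have hk : 0 < biasConst δ * (η + ε) ^ (3 / 4 : ℝ) :=
    mul_pos (biasConst_pos hδ) (Real.rpow_pos_of_pos (by linarith) _)
  refine le_mul_of_forall_gt hk fun B' hB' => ?_
  exact abs_integral_cond_interval_sub_le_of_pos hδ hη hη1 hε hm hq hL (hB0.trans_lt hB')
    (hB.trans (pow_le_pow_left₀ hB0 hB'.le 4)) hI

end Interval

/-! ### Treatment arms and conditioning on treatment -/

variable {W : Type*} [MeasurableSpace W]

/-- The joint law of `(W, T)` when `W` has law `m` and `T = t`. -/
noncomputable def arm (m : Measure W) (t : Fin 2) : Measure (W × Fin 2) :=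
  m.map fun w => (w, t)

instance (m : Measure W) [IsProbabilityMeasure m] (t : Fin 2) : IsProbabilityMeasure (arm m t) :=
  Measure.isProbabilityMeasure_map (by fun_prop)

instance (m : Measure W) [IsFiniteMeasure m] (t : Fin 2) : IsFiniteMeasure (arm m t) := by
  unfold arm; infer_instance

instance (D : Measure ((W × Fin 2) × ℝ)) [IsProbabilityMeasure D] :
    IsProbabilityMeasure (lawW D) := by
  unfold lawW; infer_instance

lemma measurableSet_snd_eq (t : Fin 2) : MeasurableSet {x : W × Fin 2 | x.2 = t} :=
  measurable_snd (measurableSet_singleton t)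

lemma measurableSet_treated (t : Fin 2) : MeasurableSet (treated W t) :=
  measurable_fst (measurableSet_snd_eq t)

lemma restrict_snd_eq_arm (ρ : Measure (W × Fin 2)) (t : Fin 2) :
    ρ.restrict {x | x.2 = t} = arm (ρ.restrict {x | x.2 = t}).fst t := by
  have h : (fun x : W × Fin 2 => (x.1, t)) =ᵐ[ρ.restrict {x | x.2 = t}] id := by
    filter_upwards [ae_restrict_mem (measurableSet_snd_eq t)] with x hx
    exact Prod.ext rfl (Eq.symm hx)
  rw [arm, Measure.fst, Measure.map_map (by fun_prop) measurable_fst]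
  change _ = Measure.map (fun x : W × Fin 2 => (x.1, t)) _
  rw [Measure.map_congr h, Measure.map_id]

lemma restrict_treated_compProd (ρ : Measure (W × Fin 2)) [SFinite ρ]
    (k : Kernel (W × Fin 2) ℝ) [IsSFiniteKernel k] (t : Fin 2) :
    (ρ ⊗ₘ k).restrict (treated W t) = ρ.restrict {x | x.2 = t} ⊗ₘ k := by
  ext s hs
  rw [Measure.restrict_apply hs, Measure.compProd_apply (hs.inter (measurableSet_treated t)),
    Measure.compProd_apply hs, ← lintegral_indicator (measurableSet_snd_eq t)]
  refine lintegral_congr fun x => ?_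
  by_cases hx : x.2 = t
  · rw [Set.indicator_of_mem (by exact hx)]
    congr 1
    ext y
    simp [treated, hx]
  · rw [Set.indicator_of_notMem (by exact hx)]
    have : Prod.mk x ⁻¹' (s ∩ treated W t) = ∅ := by
      ext y
      simp [treated, hx]
    rw [this, measure_empty]

/-- Under overlap, almost sure properties of `(W, T)` hold in both arms for almost every `w`. -/
lemma Overlap.arm_absolutelyContinuous {Q : Measure ((W × Fin 2) × ℝ)} [IsFiniteMeasure Q]
    (h : Overlap Q) (t : Fin 2) : arm (lawW Q) t ≪ Q.fst := by
  refine Measure.AbsolutelyContinuous.mk fun s hs h0 => ?_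
  rw [arm, Measure.map_apply (by fun_prop) hs]
  have h1 : ∀ᵐ x ∂(Q.fst.fst ⊗ₘ Q.fst.condKernel), x ∉ s := by
    rw [Q.fst.disintegrate Q.fst.condKernel]
    exact measure_eq_zero_iff_ae_notMem.1 h0
  refine measure_eq_zero_iff_ae_notMem.2 ?_
  have h2 : ∀ᵐ w ∂lawW Q, ∀ᵐ t' ∂Q.fst.condKernel w, (w, t') ∉ s :=
    Measure.ae_ae_of_ae_compProd h1
  filter_upwards [h2, h t] with w hw hpos hmem
  -- If `(w, t)` were in `s`, the null section of `s` at `w` would contain `t`, an atom by overlap.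
  refine hpos.ne' (measure_mono_null ?_ hw)
  rintro _ rfl
  simpa using hmem

section Cond

variable {D : Measure ((W × Fin 2) × ℝ)} {m : Measure W} [IsProbabilityMeasure m]
  {k : Kernel (W × Fin 2) ℝ} [IsMarkovKernel k] {t : Fin 2} {p : ℝ≥0∞}

lemma cond_treated_eq (h : D.restrict (treated W t) = p • (arm m t ⊗ₘ k)) (hp : p ≠ 0)
    (hp' : p ≠ ∞) : D[|treated W t] = arm m t ⊗ₘ k := by
  have hD : D (treated W t) = p := by
    rw [← Measure.restrict_apply_univ, h]
    simp
  rw [ProbabilityTheory.cond, h, hD, smul_smul, ENNReal.inv_mul_cancel hp hp', one_smul]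

lemma meanGiven_eq (h : D[|treated W t] = arm m t ⊗ₘ k)
    (hint : Integrable (fun ω => ω.2) (arm m t ⊗ₘ k)) :
    Integrable (fun w => ∫ y, y ∂k (w, t)) m ∧
      meanGiven D t = ∫ w, ∫ y, y ∂k (w, t) ∂m := by
  have hmeas : StronglyMeasurable fun x => ∫ y, y ∂k x :=
    StronglyMeasurable.integral_kernel (f := fun y : ℝ => y) stronglyMeasurable_id
  have hpair : Measurable fun w : W => (w, t) := by fun_prop
  constructor
  · have h1 : Integrable (fun x => ∫ y, y ∂k x) (arm m t) :=
      Measure.integrable_compProd_iff hint.aestronglyMeasurable |>.1 hint |>.2.mono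
        hmeas.aestronglyMeasurable (Filter.Eventually.of_forall fun x => by
          refine (norm_integral_le_integral_norm _).trans ?_
          exact le_abs_self _)
    exact h1.comp_measurable hpair
  · rw [meanGiven, h, Measure.integral_compProd hint, arm,
      integral_map hpair.aemeasurable hmeas.aestronglyMeasurable]

end Cond

lemma IsTarget.restrict_treated {κ : Kernel (W × Fin 2) ℝ} [IsMarkovKernel κ]
    {P : Measure ((W × Fin 2) × ℝ)} [IsProbabilityMeasure P] (h : IsTarget κ P) (t : Fin 2) :
    P.restrict (treated W t) = P.fst.snd {t} • (arm (lawW P) t ⊗ₘ κ) := by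
  have h1 : P.fst.restrict {x | x.2 = t} = P.fst.snd {t} • arm (lawW P) t := by
    have hs : {x : W × Fin 2 | x.2 = t} = Set.univ ×ˢ {t} := by ext; simp
    conv_lhs => rw [h.randomized, hs]
    rw [← Measure.prod_restrict, Measure.restrict_univ, Measure.restrict_singleton,
      Measure.prod_smul_right, Measure.prod_dirac]
    rfl
  conv_lhs => rw [h.mechanism]
  rw [restrict_treated_compProd, h1, Measure.compProd_smul_left]

/-! ### Inverse probability weighting -/

lemma measurable_ipwWeight (D : Measure ((W × Fin 2) × ℝ)) :
    Measurable fun x : W × Fin 2 => ipwWeight D x.1 x.2 :=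
  measurable_from_prod_countable_left fun t =>
    Measure.measurable_rnDeriv (lawW D) (lawWGiven D t)

/-- The IPW representation makes the treatment arms carry the marginal law of the covariates. -/
lemma ipwRepresentation_restrict_treated {D : Measure ((W × Fin 2) × ℝ)} [IsProbabilityMeasure D]
    {t : Fin 2} (hac : arm (lawW D) t ≪ D.fst) :
    D (treated W t) ≠ 0 ∧ (ipwRepresentation D).restrict (treated W t) =
      D (treated W t) • (arm (lawW D) t ⊗ₘ D.condKernel) := by
  set A : Set (W × Fin 2) := {x | x.2 = t} with hA
  have hAm : MeasurableSet A := measurableSet_snd_eq t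
  have hDA : D (treated W t) = D.fst A := by
    rw [Measure.fst_apply hAm]; rfl
  have hp : D (treated W t) ≠ 0 := by
    rw [hDA]
    intro h0
    have := hac h0
    rw [arm, Measure.map_apply (by fun_prop) hAm] at this
    simp [hA] at this
  have hp' : D (treated W t) ≠ ∞ := measure_ne_top _ _
  refine ⟨hp, ?_⟩
  set p := D (treated W t) with hpdef
  set M : Measure W := (D.fst.restrict A).fst with hM
  have hrestr : D.restrict (treated W t) = arm M t ⊗ₘ D.condKernel := by
    conv_lhs => rw [← D.disintegrate D.condKernel]
    rw [restrict_treated_compProd, restrict_snd_eq_arm]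
  have hL : lawWGiven D t = p⁻¹ • M := by
    rw [lawWGiven, lawW, ProbabilityTheory.cond, hrestr, Measure.fst, Measure.fst,
      Measure.map_smul, Measure.map_smul]
    change p⁻¹ • (arm M t ⊗ₘ D.condKernel).fst.fst = _
    rw [Measure.fst_compProd, hM, ← restrict_snd_eq_arm]
  have hML : M = p • lawWGiven D t := by
    rw [hL, smul_smul, ENNReal.mul_inv_cancel hp hp', one_smul]
  have hfin : IsFiniteMeasure (lawWGiven D t) := by
    unfold lawWGiven lawW; infer_instance
  -- Without this the Radon-Nikodym weight would recover only the absolutely continuous part of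
  -- `D(W)`.
  have hacL : lawW D ≪ lawWGiven D t := by
    refine Measure.AbsolutelyContinuous.mk fun s hs h0 => ?_
    have h1 : M s = 0 := by rw [hML]; simp [h0]
    rw [hM, Measure.fst_apply hs, Measure.restrict_apply (measurable_fst hs)] at h1
    have h2 := hac h1
    rw [arm, Measure.map_apply (by fun_prop) ((measurable_fst hs).inter hAm)] at h2
    convert h2 using 2
    ext w
    simp [hA]
  have hβ := measurable_ipwWeight D
  ext s hs
  have hβs : Measurable (s.indicator
      fun ω : (W × Fin 2) × ℝ => ipwWeight D ω.1.1 ω.1.2) :=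
    (hβ.comp measurable_fst).indicator hs
  have hF : Measurable fun x => D.condKernel x (Prod.mk x ⁻¹' s) :=
    Kernel.measurable_kernel_prodMk_left hs
  have hβF : Measurable fun x : W × Fin 2 =>
      ipwWeight D x.1 x.2 * D.condKernel x (Prod.mk x ⁻¹' s) := hβ.mul hF
  have hpair : Measurable fun w : W => (w, t) := by fun_prop
  rw [ipwRepresentation, restrict_withDensity (measurableSet_treated t), hrestr,
    withDensity_apply _ hs, ← lintegral_indicator hs,
    Measure.lintegral_compProd hβs,
    Measure.smul_apply, Measure.compProd_apply hs, smul_eq_mul]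
  have hinner : ∀ x : W × Fin 2, ∫⁻ y, s.indicator
      (fun ω : (W × Fin 2) × ℝ => ipwWeight D ω.1.1 ω.1.2) (x, y) ∂D.condKernel x =
      ipwWeight D x.1 x.2 * D.condKernel x (Prod.mk x ⁻¹' s) := fun x => by
    rw [← lintegral_indicator_const (measurable_prodMk_left hs)]
    rfl
  simp_rw [hinner]
  rw [arm, lintegral_map hβF hpair, arm, lintegral_map hF hpair, hML,
    lintegral_smul_measure, smul_eq_mul]
  congr 1
  exact lintegral_rnDeriv_mul hacL (hF.comp hpair).aemeasurable

/-! ### The conditional estimate, for almost every `(w, t)` -/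

lemma measurable_sigma (κ : Kernel (W × Fin 2) ℝ) [IsMarkovKernel κ] : Measurable (sigma κ) := by
  have hmean : Measurable fun x => ∫ y, y ∂κ x :=
    (StronglyMeasurable.integral_kernel (f := fun y : ℝ => y) stronglyMeasurable_id).measurable
  have hvar : Measurable fun x => variance id (κ x) := by
    unfold variance evariance
    refine Measurable.ennreal_toReal (Measurable.lintegral_kernel_prod_right ?_)
    exact ((measurable_snd.sub (hmean.comp measurable_fst)).enorm).pow_const 2
  have hsd : ∀ t, Measurable fun w => condSD κ w t := fun t =>
    (hvar.comp (by fun_prop : Measurable fun w : W => (w, t))).sqrt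
  exact (hsd 0).max (hsd 1)

lemma condSD_nonneg (κ : Kernel (W × Fin 2) ℝ) (w : W) (t : Fin 2) : 0 ≤ condSD κ w t :=
  Real.sqrt_nonneg _

lemma condSD_le_sigma (κ : Kernel (W × Fin 2) ℝ) (w : W) (t : Fin 2) :
    condSD κ w t ≤ sigma κ w := by
  fin_cases t
  · exact le_max_left _ _
  · exact le_max_right _ _

lemma sigma_nonneg (κ : Kernel (W × Fin 2) ℝ) (w : W) : 0 ≤ sigma κ w :=
  (condSD_nonneg κ w 0).trans (condSD_le_sigma κ w 0)

/-- The outcome law of the robust version is concentrated near the mean of the mechanism, and its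
own mean is close to it. -/
lemma ae_robust_bound {U : Type*} [MeasurableSpace U] {δ η ε C : ℝ} (hδ : 0 < δ) (hη : 0 ≤ η)
    (hη1 : η ≤ 1) (hε : 0 < ε) (hC : 0 ≤ C) (hm : η + δ ≤ (1 - η) * (1 - η - ε))
    {κ : Kernel (W × Fin 2) ℝ} [IsMarkovKernel κ] {ν : Kernel (W × Fin 2) U}
    {N : Kernel ((W × Fin 2) × U) ℝ}
    {Q QB : Measure ((W × Fin 2) × ℝ)} [IsProbabilityMeasure Q] [IsProbabilityMeasure QB]
    (hH : IsHuberContaminated η κ ν N Q) (hF : FourthMomentBound C κ Q)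
    (hR : IsRobustVersion η ε Q QB) :
    ∀ᵐ x ∂Q.fst,
      (∀ᵐ y ∂QB.condKernel x, |y - ∫ z, z ∂κ x| ≤
        rangeConst δ / (η + ε) ^ (1 / 4 : ℝ) * (C ^ (1 / 4 : ℝ) * sigma κ x.1)) ∧
      |(∫ y, y ∂QB.condKernel x) - ∫ z, z ∂κ x| ≤
        biasConst δ * (η + ε) ^ (3 / 4 : ℝ) * (C ^ (1 / 4 : ℝ) * sigma κ x.1) := by
  filter_upwards [hH, hF, hR.2] with x hx hfx hRx
  obtain ⟨a, b, hI, hQB⟩ := hRx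
  have hC4 : 0 ≤ C ^ (1 / 4 : ℝ) := Real.rpow_nonneg hC _
  have hB0 : 0 ≤ C ^ (1 / 4 : ℝ) * sigma κ x.1 := mul_nonneg hC4 (sigma_nonneg κ _)
  have hB : ∫ y, (y - ∫ z, z ∂κ x) ^ 4 ∂κ x ≤ (C ^ (1 / 4 : ℝ) * sigma κ x.1) ^ 4 := by
    refine hfx.2.trans ?_
    have h4 : (C ^ (1 / 4 : ℝ)) ^ 4 = C := by
      rw [← Real.rpow_natCast, ← Real.rpow_mul hC]; norm_num
    rw [mul_pow, h4]
    exact mul_le_mul_of_nonneg_left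
      (pow_le_pow_left₀ (condSD_nonneg κ _ _) (condSD_le_sigma κ _ _) 4) hC
  rw [hQB]
  refine ⟨?_, abs_integral_cond_interval_sub_le hδ hη hη1 hε hm hx hfx.1 hB0 hB hI⟩
  filter_upwards [ae_cond_mem measurableSet_Icc] with y hy
  exact abs_sub_le_of_mem_interval hδ hη hη1 hε hm hx (integrable_sub_pow_four hfx.1 _) hB0 hB hI hy

/-- A quantity dominated by an integral is the integral of a dominated function. -/
lemma exists_integral_eq_of_le {m : Measure W} {f : W → ℝ} (hf : Measurable f) (hf0 : ∀ w, 0 ≤ f w)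
    {x : ℝ} (hx0 : 0 ≤ x) (hx : x ≤ ∫ w, f w ∂m) :
    ∃ g : W → ℝ, Measurable g ∧ (∀ w, 0 ≤ g w ∧ g w ≤ f w) ∧ x = ∫ w, g w ∂m := by
  rcases (hx0.trans hx).eq_or_lt with h | h
  · exact ⟨f, hf, fun w => ⟨hf0 w, le_rfl⟩, by linarith⟩
  -- Scaling `f` by the ratio `x / ∫ f ≤ 1` gives the exact integral.
  · refine ⟨fun w => x / (∫ w, f w ∂m) * f w, hf.const_mul _, fun w => ⟨?_, ?_⟩, ?_⟩
    · exact mul_nonneg (div_nonneg hx0 h.le) (hf0 w)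
    · exact mul_le_of_le_one_left (hf0 w) ((div_le_one h).2 hx)
    · rw [integral_const_mul, div_mul_cancel₀ _ h.ne']

end CausalIPW

/-! ### Assembly of the two arms -/

open CausalIPW

theorem corollary5p2p1 (δ : ℝ) (hδ : 0 < δ) :
    ∃ K : ℝ, 0 < K ∧
      ∀ (W : Type*) [MeasurableSpace W] (U : Type*) [MeasurableSpace U]
        (η ε C : ℝ) (_ : 0 ≤ η) (_ : η ≤ 1) (_ : 0 < ε) (_ : 0 ≤ C)
        (_ : η + δ ≤ (1 - η) * (1 - η - ε))
        (κ : Kernel (W × Fin 2) ℝ) [IsMarkovKernel κ]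
        (ν : Kernel (W × Fin 2) U) [IsMarkovKernel ν]
        (N : Kernel ((W × Fin 2) × U) ℝ) [IsMarkovKernel N]
        (P Q QB : Measure ((W × Fin 2) × ℝ))
        [IsProbabilityMeasure P] [IsProbabilityMeasure Q] [IsProbabilityMeasure QB]
        (_ : CausalIPW.IsHuberContaminated η κ ν N Q)
        (_ : CausalIPW.Overlap Q)
        (_ : CausalIPW.FourthMomentBound C κ Q)
        (_ : Integrable (CausalIPW.sigma κ) (CausalIPW.lawW Q))
        (_ : CausalIPW.IsTarget κ P)
        (_ : Integrable (fun ω => ω.2) P)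
        (_ : CausalIPW.lawW P = CausalIPW.lawW Q)
        (_ : CausalIPW.IsRobustVersion η ε Q QB),
        Integrable (fun ω => ω.2) (CausalIPW.ipwRepresentation QB) ∧
        ∃ g : W → ℝ, Measurable g ∧
          (∀ w, 0 ≤ g w ∧
            g w ≤ K * (C ^ (1 / 4 : ℝ) * (η + ε) ^ (3 / 4 : ℝ) * CausalIPW.sigma κ w)) ∧
          CausalIPW.lossL1 (CausalIPW.hInf (CausalIPW.ipwRepresentation QB))
              (CausalIPW.hInf P) =
            2 * ∫ w, g w ∂(CausalIPW.lawW Q) := by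
  refine ⟨CausalIPW.biasConst δ, CausalIPW.biasConst_pos hδ, ?_⟩
  intro W _ U _ η ε C hη hη1 hε hC hm κ _ ν _ N _ P Q QB _ _ _ hH hO hF hσ hT hP hPQ hR

  have hlaw : lawW QB = lawW Q := by rw [lawW, hR.1, lawW]
  have hac : ∀ t, arm (lawW Q) t ≪ Q.fst := hO.arm_absolutelyContinuous
  have hbound := ae_robust_bound hδ hη hη1 hε hC hm hH hF hR
  have hmean : Measurable fun x => ∫ y, y ∂κ x :=
    (StronglyMeasurable.integral_kernel (f := fun y : ℝ => y) stronglyMeasurable_id).measurable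
  have hσm := measurable_sigma κ
  have hpair : ∀ t : Fin 2, Measurable fun w : W => (w, t) := fun t => by fun_prop
  -- the target
  have hPt : ∀ t, P[|treated W t] = arm (lawW Q) t ⊗ₘ κ := fun t => by
    rw [← hPQ]
    exact cond_treated_eq (hT.restrict_treated t) (hT.both_arms t).ne' (measure_ne_top _ _)
  have hPint : ∀ t, Integrable (fun ω => ω.2) (arm (lawW Q) t ⊗ₘ κ) := fun t => by
    rw [← hPt t]
    refine hP.restrict.smul_measure (ENNReal.inv_ne_top.2 fun h0 => ?_)
    have := hPt t
    rw [ProbabilityTheory.cond, Measure.restrict_eq_zero.2 h0, smul_zero] at this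
    have h1 := congrArg (fun μ => μ Set.univ) this
    simp at h1
  have hPmean := fun t => meanGiven_eq (hPt t) (hPint t)
  -- the reweighted robust distribution
  have hRt : ∀ t, QB (treated W t) ≠ 0 ∧ (ipwRepresentation QB).restrict (treated W t) =
      QB (treated W t) • (arm (lawW Q) t ⊗ₘ QB.condKernel) := fun t => by
    have := ipwRepresentation_restrict_treated (D := QB) (t := t) (by
      rw [hlaw, hR.1]; exact hac t)
    rwa [hlaw] at this
  have hRint : ∀ t, Integrable (fun ω => ω.2) (arm (lawW Q) t ⊗ₘ QB.condKernel) := fun t => by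
    set A := rangeConst δ / (η + ε) ^ (1 / 4 : ℝ)
    -- `Y` stays within a multiple of `σ` of the mean of `κ`, and that mean is integrable over
    -- `Q(W)` because `Y` is integrable under `P`.
    have hdom : Integrable (fun x : W × Fin 2 => |∫ z, z ∂κ x| +
        A * (C ^ (1 / 4 : ℝ) * sigma κ x.1)) (arm (lawW Q) t) := by
      rw [arm, integrable_map_measure (by fun_prop) (hpair t).aemeasurable]
      exact (hPmean t).1.abs.add ((hσ.const_mul _).const_mul _)
    have hdom' : Integrable (fun ω : (W × Fin 2) × ℝ => |∫ z, z ∂κ ω.1| +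
        A * (C ^ (1 / 4 : ℝ) * sigma κ ω.1.1)) (arm (lawW Q) t ⊗ₘ QB.condKernel) := by
      rw [← Measure.fst_compProd (arm (lawW Q) t) QB.condKernel] at hdom
      exact hdom.comp_measurable measurable_fst
    refine hdom'.mono' (by fun_prop) (Measure.ae_compProd_of_ae_ae ?_ ?_)
    · exact measurableSet_le (by fun_prop) (((hmean.comp measurable_fst).abs).add
        (((hσm.comp (measurable_fst.comp measurable_fst)).const_mul _).const_mul _))
    · filter_upwards [(hac t).ae_le hbound] with x hx
      filter_upwards [hx.1] with y hy
      rw [Real.norm_eq_abs]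
      have := abs_sub_abs_le_abs_sub y (∫ z, z ∂κ x)
      linarith
  have hRmean := fun t => meanGiven_eq
    (cond_treated_eq (hRt t).2 (hRt t).1 (measure_ne_top _ _)) (hRint t)
  constructor
  · have hcover : (Set.univ : Set ((W × Fin 2) × ℝ)) = treated W 0 ∪ treated W 1 := by
      ext ω
      have : ω.1.2 = 0 ∨ ω.1.2 = 1 := by omega
      simpa [treated] using this
    have hon : ∀ t, IntegrableOn (fun ω => ω.2) (treated W t) (ipwRepresentation QB) := fun t => by
      rw [IntegrableOn, (hRt t).2]
      exact (hRint t).smul_measure (measure_ne_top _ _)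
    rw [← integrableOn_univ, hcover]
    exact (hon 0).union (hon 1)
  · have hnn : 0 ≤ biasConst δ := (biasConst_pos hδ).le
    have hθ : 0 ≤ (η + ε) ^ (3 / 4 : ℝ) := Real.rpow_nonneg (by linarith) _
    have hC4 : 0 ≤ C ^ (1 / 4 : ℝ) := Real.rpow_nonneg hC _
    set f : W → ℝ := fun w =>
      biasConst δ * (C ^ (1 / 4 : ℝ) * (η + ε) ^ (3 / 4 : ℝ) * sigma κ w) with hf
    have hfint : Integrable f (lawW Q) := (hσ.const_mul _).const_mul _
    have harm : ∀ t, |meanGiven (ipwRepresentation QB) t - meanGiven P t| ≤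
        ∫ w, f w ∂(lawW Q) := fun t => by
      rw [(hRmean t).2, (hPmean t).2, ← integral_sub (hRmean t).1 (hPmean t).1]
      refine abs_integral_le_integral_abs.trans
        (integral_mono_ae ((hRmean t).1.sub (hPmean t).1).abs hfint ?_)
      have := (hac t).ae_le hbound
      filter_upwards [ae_of_ae_map (hpair t).aemeasurable this] with w hw
      refine hw.2.trans (le_of_eq ?_)
      simp only [hf]
      ring
    have hloss : lossL1 (hInf (ipwRepresentation QB)) (hInf P) / 2 ≤ ∫ w, f w ∂(lawW Q) := by
      have h0 := harm 0
      have h1 := harm 1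
      rw [abs_le] at h0 h1
      rw [div_le_iff₀ two_pos, lossL1, hInf, hInf, abs_le]
      constructor <;> linarith
    obtain ⟨g, hg, hgf, hgx⟩ := exists_integral_eq_of_le (m := lawW Q) (f := f) (by fun_prop)
      (fun w => mul_nonneg hnn (mul_nonneg (mul_nonneg hC4 hθ) (sigma_nonneg κ w)))
      (div_nonneg (abs_nonneg _) two_pos.le) hloss
    exact ⟨g, hg, hgf, by rw [← hgx, lossL1]; ring⟩
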